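/- Let $\mathcal A_1$ and $\mathcal A_2$ be unital separable C$^*$-algebras with faithful tracial states $\tau_1$ and $\tau_2$ respectively. Suppose that $\mathcal A_1$ and $\mathcal A_2$ satisfy Avitzour's condition, i.e. there are unitaries $u\in\mathcal A_1$ and $v,w\in\mathcal A_2$ such that $$\tau_1(u)=\tau_2(v)=\tau_2(w)=\tau_2(w^*v)=0 .$$ Then the reduced free product $(\mathcal A_1,\tau_1)*_{red}(\mathcal A_2,\tau_2)$ is not a quasidiagonal C$^*$-algebra. Here the reduced free product is the C$^*$-algebra generated by $\lambda_1(\mathcal A_1)\cup\lambda_2(\mathcal A_2)$ in $B(\mathcal H)$, where $(\mathcal H_i,\xi_i,\pi_i)$ is the GNS representation of $\tau_i$, $\mathring{\mathcal H}_i=\mathcal H_i\ominus\mathbb C\xi_i$, $\mathcal H=\mathbb C\xi\oplus\bigoplus_{n\ge 1}\bigoplus_{j_1\ne j_2\ne\cdots\ne j_n}\mathring{\mathcal H}_{j_1}\otimes\cdots\otimes\mathring{\mathcal H}_{j_n}$, $\mathcal H(i)$ is the subspace of $\mathcal H$ given by $\mathbb C\xi$ and the summands with $j_1\ne i$, $V_i:\mathcal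 H_i\otimes\mathcal H(i)\to\mathcal H$ is the canonical unitary, and $\lambda_i(x)=V_i(\pi_i(x)\otimes I)V_i^*$. A separable C$^*$-algebra $\mathcal A$ is quasidiagonal if there are a faithful $*$-representation $\pi:\mathcal A\to B(\mathcal K)$ and an increasing sequence of finite-rank projections $p_n$ on $\mathcal K$ tending strongly to the identity such that $\|\pi(x)p_n-p_n\pi(x)\|\to 0$ for every $x\in\mathcal A$. -/

import Mathlib

open scoped TensorProduct ComplexOrder Topology
open Filter

universe u w

/-- The Hilbert space tensor product: the completion of the algebraic tensor product for the
inner product determined by `⟪a ⊗ b, c ⊗ d⟫ = ⟪a, c⟫ * ⟪b, d⟫`. -/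
abbrev HilbertTensor (E F : Type*) [NormedAddCommGroup E] [InnerProductSpace ℂ E]
    [NormedAddCommGroup F] [InnerProductSpace ℂ F] : Type _ :=
  UniformSpace.Completion (E ⊗[ℂ] F)

namespace HilbertTensor

variable {E E' F F' : Type*}
  [NormedAddCommGroup E] [InnerProductSpace ℂ E] [NormedAddCommGroup E'] [InnerProductSpace ℂ E']
  [NormedAddCommGroup F] [InnerProductSpace ℂ F] [NormedAddCommGroup F'] [InnerProductSpace ℂ F']

/-- The elementary tensor `e ⊗ f`. -/
noncomputable def tmul (e : E) (f : F) : HilbertTensor E F :=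
  ((e ⊗ₜ[ℂ] f : E ⊗[ℂ] F) : UniformSpace.Completion (E ⊗[ℂ] F))

/-- The tensor product `x ⊗ y` of two bounded operators, on the Hilbert space tensor product. -/
noncomputable def map (x : E →L[ℂ] E') (y : F →L[ℂ] F') :
    HilbertTensor E F →L[ℂ] HilbertTensor E' F' :=
  (TensorProduct.mapL x y).completion

theorem map_tmul (x : E →L[ℂ] E') (y : F →L[ℂ] F') (e : E) (f : F) :
    map x y (tmul e f) = tmul (x e) (y f) :=
  (TensorProduct.mapL x y).completion_apply_coe _

theorem inner_tmul (e e' : E) (f f' : F) :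
    inner ℂ (tmul e f) (tmul e' f') = inner ℂ e e' * inner ℂ f f' :=
  (UniformSpace.Completion.inner_coe _ _).trans (TensorProduct.inner_tmul ..)

theorem add_tmul (e e' : E) (f : F) : tmul (e + e') f = tmul e f + tmul e' f :=
  (congrArg _ (TensorProduct.add_tmul ..)).trans (UniformSpace.Completion.coe_add _ _)

theorem tmul_add (e : E) (f f' : F) : tmul e (f + f') = tmul e f + tmul e f' :=
  (congrArg _ (TensorProduct.tmul_add ..)).trans (UniformSpace.Completion.coe_add _ _)

theorem smul_tmul (c : ℂ) (e : E) (f : F) : tmul (c • e) f = c • tmul e f :=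
  (congrArg _ (TensorProduct.smul_tmul' ..).symm).trans (UniformSpace.Completion.coe_smul _ _)

theorem tmul_smul (c : ℂ) (e : E) (f : F) : tmul e (c • f) = c • tmul e f :=
  (congrArg _ (TensorProduct.tmul_smul ..)).trans (UniformSpace.Completion.coe_smul _ _)

theorem mem_of_tmul_mem (S : Submodule ℂ (HilbertTensor E F))
    (hS : IsClosed (S : Set (HilbertTensor E F))) (h : ∀ e f, tmul e f ∈ S)
    (x : HilbertTensor E F) : x ∈ S := by
  induction x using UniformSpace.Completion.induction_on with
  | hp => exact hS
  | ih x =>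
    induction x with
    | zero => exact S.zero_mem
    | add s t hs ht =>
      rw [UniformSpace.Completion.coe_add]
      exact S.add_mem hs ht
    | tmul e f => exact h e f

end HilbertTensor

/-- A bundled complex Hilbert space, used to define a family of Hilbert spaces by recursion. -/
structure BundledHilbert where
  /-- The underlying type. -/
  carrier : Type u
  [normed : NormedAddCommGroup carrier]
  [inner : InnerProductSpace ℂ carrier]
  [complete : CompleteSpace carrier]

attribute [instance] BundledHilbert.normed BundledHilbert.inner BundledHilbert.complete

namespace FreeProd

section Words

/-- The words `[j₁, …, jₙ]` with `j₁ ≠ j₂ ≠ ⋯ ≠ jₙ`, including the empty one. -/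
abbrev Word (ι : Type) : Type := {l : List ι // l.IsChain (· ≠ ·)}

/-- The words `[j₁, …, jₙ]` with `i ≠ j₁ ≠ j₂ ≠ ⋯ ≠ jₙ`, including the empty one. -/
abbrev WordAvoiding {ι : Type} (i : ι) : Type := {l : List ι // (i :: l).IsChain (· ≠ ·)}

variable {ι : Type}

/-- A word that avoids the initial letter `i`, as a word. -/
abbrev WordAvoiding.incl {i : ι} (l : WordAvoiding i) : Word ι := ⟨l.1, l.2.tail⟩

/-- The word `i :: l`, for a word `l` that avoids the initial letter `i`. -/
abbrev WordAvoiding.cons {i : ι} (l : WordAvoiding i) : Word ι := ⟨i :: l.1, l.2⟩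

theorem WordAvoiding.incl_injective {i : ι} :
    Function.Injective (WordAvoiding.incl : WordAvoiding i → Word ι) := by
  rintro ⟨l, hl⟩ ⟨m, hm⟩ h
  have h' : l = m := congrArg Subtype.val h
  subst h'
  rfl

theorem WordAvoiding.cons_injective {i : ι} :
    Function.Injective (WordAvoiding.cons : WordAvoiding i → Word ι) := by
  rintro ⟨l, hl⟩ ⟨m, hm⟩ h
  have h' : i :: l = i :: m := congrArg Subtype.val h
  simp only [List.cons.injEq, true_and] at h'
  subst h'
  rfl

theorem WordAvoiding.incl_ne_cons {i : ι} (l m : WordAvoiding i) : l.incl ≠ m.cons := by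
  obtain ⟨l, hl⟩ := l
  obtain ⟨m, hm⟩ := m
  intro h
  have h' : l = i :: m := congrArg Subtype.val h
  subst h'
  simp at hl

theorem Word.eq_incl_or_eq_cons (i : ι) (w : Word ι) :
    (∃ l : WordAvoiding i, l.incl = w) ∨ ∃ l : WordAvoiding i, l.cons = w := by
  obtain ⟨_ | ⟨j, l⟩, h⟩ := w
  · exact .inl ⟨⟨[], List.isChain_singleton i⟩, rfl⟩
  · by_cases hj : j = i
    · subst hj
      exact .inr ⟨⟨l, h⟩, rfl⟩
    · exact .inl ⟨⟨j :: l, List.isChain_cons_cons.2 ⟨Ne.symm hj, h⟩⟩, rfl⟩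

theorem WordAvoiding.isCompl_range (i : ι) :
    IsCompl (Set.range (WordAvoiding.incl : WordAvoiding i → Word ι))
      (Set.range (WordAvoiding.cons : WordAvoiding i → Word ι)) := by
  refine isCompl_iff.2 ⟨Set.disjoint_left.2 ?_, codisjoint_iff.2 (Set.eq_univ_of_forall ?_)⟩
  · rintro _ ⟨l, rfl⟩ ⟨m, hm⟩
    exact WordAvoiding.incl_ne_cons l m hm.symm
  · exact fun w => Word.eq_incl_or_eq_cons i w

theorem Word.hasSum {i : ι} {g : Word ι → ℂ} {a b : ℂ}
    (ha : HasSum (fun l : WordAvoiding i => g l.incl) a)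
    (hb : HasSum (fun l : WordAvoiding i => g l.cons) b) : HasSum g (a + b) :=
  HasSum.add_isCompl (WordAvoiding.isCompl_range i)
    (WordAvoiding.incl_injective.hasSum_range_iff.2 ha)
    (WordAvoiding.cons_injective.hasSum_range_iff.2 hb)

end Words

section Space

variable {ι : Type} (H : ι → Type u) [∀ i, NormedAddCommGroup (H i)]
  [∀ i, InnerProductSpace ℂ (H i)] (ξ : ∀ i, H i)

/-- `H° i = H i ⊖ ℂ ξ i`, the orthogonal complement of the distinguished vector. -/
noncomputable abbrev Reduced (i : ι) : Submodule ℂ (H i) := (ℂ ∙ ξ i)ᗮ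

/-- The Hilbert space `H° j₁ ⊗ ⋯ ⊗ H° jₙ` attached to the word `[j₁, …, jₙ]`, by recursion on the
word. The empty word gives the one-dimensional space `ℂ ξ`. -/
noncomputable def wordBundle : List ι → BundledHilbert.{u}
  | [] => ⟨EuclideanSpace ℂ PUnit.{u + 1}⟩
  | i :: l => ⟨HilbertTensor (Reduced H ξ i) (wordBundle l).carrier⟩

/-- The Hilbert space `H° j₁ ⊗ ⋯ ⊗ H° jₙ` attached to the word `[j₁, …, jₙ]`. -/
abbrev WordSpace (l : List ι) : Type u := (wordBundle H ξ l).carrier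

/-- The Hilbert space free product of the `(H i, ξ i)`: the Hilbert sum of `ℂ ξ` and of all
`H° j₁ ⊗ ⋯ ⊗ H° jₙ` with `n ≥ 1` and `j₁ ≠ j₂ ≠ ⋯ ≠ jₙ`. -/
abbrev Space : Type u := lp (fun l : Word ι => WordSpace H ξ l.1) 2

/-- The Hilbert space `H(i)`: the Hilbert sum of `ℂ ξ` and of all
`H° j₁ ⊗ ⋯ ⊗ H° jₙ` with `n ≥ 1` and `i ≠ j₁ ≠ j₂ ≠ ⋯ ≠ jₙ`. -/
abbrev SpaceAvoiding (i : ι) : Type u := lp (fun l : WordAvoiding i => WordSpace H ξ l.1) 2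

variable {H ξ} in
/-- The elementary tensor `θ ⊗ t` in `H° i ⊗ (H° j₁ ⊗ ⋯ ⊗ H° jₙ)`. -/
noncomputable def tmul {i : ι} {l : List ι} (θ : Reduced H ξ i) (t : WordSpace H ξ l) :
    WordSpace H ξ (i :: l) :=
  (HilbertTensor.tmul θ t : HilbertTensor (Reduced H ξ i) (WordSpace H ξ l))

section tmul

variable {H ξ} {i : ι} {l : List ι}

theorem inner_tmul (θ θ' : Reduced H ξ i) (t t' : WordSpace H ξ l) :
    inner ℂ (tmul θ t) (tmul θ' t') = inner ℂ θ θ' * inner ℂ t t' :=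
  HilbertTensor.inner_tmul θ θ' t t'

theorem add_tmul (θ θ' : Reduced H ξ i) (t : WordSpace H ξ l) :
    tmul (θ + θ') t = tmul θ t + tmul θ' t :=
  HilbertTensor.add_tmul θ θ' t

theorem tmul_add (θ : Reduced H ξ i) (t t' : WordSpace H ξ l) :
    tmul θ (t + t') = tmul θ t + tmul θ t' :=
  HilbertTensor.tmul_add θ t t'

theorem smul_tmul (c : ℂ) (θ : Reduced H ξ i) (t : WordSpace H ξ l) :
    tmul (c • θ) t = c • tmul θ t :=
  HilbertTensor.smul_tmul c θ t

theorem tmul_smul (c : ℂ) (θ : Reduced H ξ i) (t : WordSpace H ξ l) :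
    tmul θ (c • t) = c • tmul θ t :=
  HilbertTensor.tmul_smul c θ t

theorem zero_tmul (t : WordSpace H ξ l) : tmul (0 : Reduced H ξ i) t = 0 := by
  simpa using smul_tmul 0 (0 : Reduced H ξ i) t

theorem tmul_zero (θ : Reduced H ξ i) : tmul θ (0 : WordSpace H ξ l) = 0 := by
  simpa using tmul_smul 0 θ (0 : WordSpace H ξ l)

theorem mem_of_tmul_mem (S : Submodule ℂ (WordSpace H ξ (i :: l)))
    (hS : IsClosed (S : Set (WordSpace H ξ (i :: l))))
    (h : ∀ (θ : Reduced H ξ i) (t : WordSpace H ξ l), tmul θ t ∈ S)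
    (x : WordSpace H ξ (i :: l)) : x ∈ S :=
  HilbertTensor.mem_of_tmul_mem (E := Reduced H ξ i) (F := WordSpace H ξ l) S hS h x

end tmul

theorem inner_eq_add_inner_reduced (i : ι) (hξ : ‖ξ i‖ = 1) (η η' : H i) :
    inner ℂ η η' = inner ℂ η (ξ i) * inner ℂ (ξ i) η' +
      inner ℂ ((Reduced H ξ i).orthogonalProjectionOnto η)
        ((Reduced H ξ i).orthogonalProjectionOnto η') := by
  have h : (((Reduced H ξ i).orthogonalProjectionOnto η' : Reduced H ξ i) : H i) =
      η' - inner ℂ (ξ i) η' • ξ i := by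
    have := Submodule.starProjection_orthogonal_val (K := ℂ ∙ ξ i) η'
    rw [Submodule.starProjection_unit_singleton ℂ hξ] at this
    exact this
  rw [Submodule.inner_orthogonalProjectionOnto_eq_of_mem_right, h, inner_sub_right,
    inner_smul_right]
  ring

variable {H ξ} in
theorem word_ext (i : ι) {g g' : (l : Word ι) → WordSpace H ξ l.1}
    (h₁ : ∀ l : WordAvoiding i, g l.incl = g' l.incl)
    (h₂ : ∀ l : WordAvoiding i, g l.cons = g' l.cons) : g = g' := by
  funext w
  obtain ⟨l, rfl⟩ | ⟨l, rfl⟩ := w.eq_incl_or_eq_cons i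
  · exact h₁ l
  · exact h₂ l

variable [DecidableEq ι]

/-- The component of `V i (η ⊗ f)` in the summand of the word `l`: on words that do not start with
`i` it is `⟪ξ i, η⟫ • f l`, and on words `i :: l` it is `η° ⊗ f l`, where `η°` is the projection of
`η` to `H° i`. -/
noncomputable def leftCoord (i : ι) (η : H i) (f : SpaceAvoiding H ξ i) :
    (l : Word ι) → WordSpace H ξ l.1
  | ⟨[], _⟩ => inner ℂ (ξ i) η • f ⟨[], List.isChain_singleton i⟩
  | ⟨j :: l, h⟩ =>
    if hj : j = i then tmul ((Reduced H ξ j).orthogonalProjectionOnto (hj ▸ η)) (f ⟨l, hj ▸ h⟩)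
    else inner ℂ (ξ i) η • f ⟨j :: l, List.isChain_cons_cons.2 ⟨Ne.symm hj, h⟩⟩

theorem leftCoord_incl (i : ι) (η : H i) (f : SpaceAvoiding H ξ i) (l : WordAvoiding i) :
    leftCoord H ξ i η f l.incl = inner ℂ (ξ i) η • (f l : WordSpace H ξ l.1) := by
  obtain ⟨_ | ⟨j, l⟩, h⟩ := l
  · rfl
  · have hj : j ≠ i := (List.isChain_cons_cons.1 h).1.symm
    exact dif_neg hj

theorem leftCoord_cons (i : ι) (η : H i) (f : SpaceAvoiding H ξ i) (l : WordAvoiding i) :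
    leftCoord H ξ i η f l.cons = tmul ((Reduced H ξ i).orthogonalProjectionOnto η) (f l) :=
  dif_pos rfl

theorem inner_leftCoord_incl (i : ι) (η η' : H i) (f f' : SpaceAvoiding H ξ i)
    (l : WordAvoiding i) :
    inner ℂ (leftCoord H ξ i η f l.incl) (leftCoord H ξ i η' f' l.incl) =
      inner ℂ η (ξ i) * inner ℂ (ξ i) η' * inner ℂ (f l) (f' l) := by
  rw [leftCoord_incl, leftCoord_incl, inner_smul_left, inner_smul_right, inner_conj_symm,
    mul_assoc]

theorem inner_leftCoord_cons (i : ι) (η η' : H i) (f f' : SpaceAvoiding H ξ i)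
    (l : WordAvoiding i) :
    inner ℂ (leftCoord H ξ i η f l.cons) (leftCoord H ξ i η' f' l.cons) =
      inner ℂ ((Reduced H ξ i).orthogonalProjectionOnto η)
        ((Reduced H ξ i).orthogonalProjectionOnto η') * inner ℂ (f l) (f' l) := by
  rw [leftCoord_cons, leftCoord_cons, inner_tmul]

theorem hasSum_leftCoord (i : ι) (hξ : ‖ξ i‖ = 1) (η η' : H i) (f f' : SpaceAvoiding H ξ i) :
    HasSum (fun l : Word ι => inner ℂ (leftCoord H ξ i η f l) (leftCoord H ξ i η' f' l))
      (inner ℂ η η' * inner ℂ f f') := by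
  have h := lp.hasSum_inner (𝕜 := ℂ) f f'
  have h₁ := h.mul_left (inner ℂ η (ξ i) * inner ℂ (ξ i) η')
  have h₂ := h.mul_left (inner ℂ ((Reduced H ξ i).orthogonalProjectionOnto η)
    ((Reduced H ξ i).orthogonalProjectionOnto η'))
  rw [← funext (inner_leftCoord_incl H ξ i η η' f f')] at h₁
  rw [← funext (inner_leftCoord_cons H ξ i η η' f f')] at h₂
  rw [inner_eq_add_inner_reduced H ξ i hξ, add_mul]
  exact Word.hasSum
    (g := fun l : Word ι => inner ℂ (leftCoord H ξ i η f l) (leftCoord H ξ i η' f' l)) h₁ h₂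

theorem memℓp_leftCoord (i : ι) (hξ : ‖ξ i‖ = 1) (η : H i) (f : SpaceAvoiding H ξ i) :
    Memℓp (leftCoord H ξ i η f) 2 := by
  have h := (hasSum_leftCoord H ξ i hξ η η f f).mapL Complex.reCLM
  refine memℓp_gen (h.summable.congr fun l => ?_)
  rw [Complex.reCLM_apply, inner_self_eq_norm_sq_to_K]
  norm_cast

/-- The vector `V i (η ⊗ f)` of the free product Hilbert space. -/
noncomputable def leftVec (i : ι) (hξ : ‖ξ i‖ = 1) (η : H i) (f : SpaceAvoiding H ξ i) :
    Space H ξ :=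
  ⟨leftCoord H ξ i η f, memℓp_leftCoord H ξ i hξ η f⟩

/-- The bilinear map `(η, f) ↦ V i (η ⊗ f)`. -/
noncomputable def leftBilin (i : ι) (hξ : ‖ξ i‖ = 1) :
    H i →ₗ[ℂ] SpaceAvoiding H ξ i →ₗ[ℂ] Space H ξ :=
  LinearMap.mk₂ ℂ (leftVec H ξ i hξ)
    (fun η η' f => Subtype.ext <| word_ext i
      (fun l => by
        change leftCoord H ξ i _ _ l.incl = leftCoord H ξ i _ _ l.incl + leftCoord H ξ i _ _ l.incl
        rw [leftCoord_incl, leftCoord_incl, leftCoord_incl, inner_add_right, add_smul])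
      (fun l => by
        change leftCoord H ξ i _ _ l.cons = leftCoord H ξ i _ _ l.cons + leftCoord H ξ i _ _ l.cons
        rw [leftCoord_cons, leftCoord_cons, leftCoord_cons, map_add, add_tmul]))
    (fun c η f => Subtype.ext <| word_ext i
      (fun l => by
        change leftCoord H ξ i _ _ l.incl = c • leftCoord H ξ i _ _ l.incl
        rw [leftCoord_incl, leftCoord_incl, inner_smul_right, mul_smul])
      (fun l => by
        change leftCoord H ξ i _ _ l.cons = c • leftCoord H ξ i _ _ l.cons
        rw [leftCoord_cons, leftCoord_cons, map_smul, smul_tmul]))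
    (fun η f f' => Subtype.ext <| word_ext i
      (fun l => by
        change leftCoord H ξ i _ _ l.incl = leftCoord H ξ i _ _ l.incl + leftCoord H ξ i _ _ l.incl
        rw [leftCoord_incl, leftCoord_incl, leftCoord_incl]
        exact smul_add _ _ _)
      (fun l => by
        change leftCoord H ξ i _ _ l.cons = leftCoord H ξ i _ _ l.cons + leftCoord H ξ i _ _ l.cons
        rw [leftCoord_cons, leftCoord_cons, leftCoord_cons]
        exact tmul_add _ _ _))
    (fun c η f => Subtype.ext <| word_ext i
      (fun l => by
        change leftCoord H ξ i _ _ l.incl = c • leftCoord H ξ i _ _ l.incl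
        rw [leftCoord_incl, leftCoord_incl]
        exact smul_comm _ _ _)
      (fun l => by
        change leftCoord H ξ i _ _ l.cons = c • leftCoord H ξ i _ _ l.cons
        rw [leftCoord_cons, leftCoord_cons]
        exact tmul_smul _ _ _))

theorem inner_lift_leftBilin (i : ι) (hξ : ‖ξ i‖ = 1) (s t : H i ⊗[ℂ] SpaceAvoiding H ξ i) :
    inner ℂ (TensorProduct.lift (leftBilin H ξ i hξ) s)
      (TensorProduct.lift (leftBilin H ξ i hξ) t) = inner ℂ s t := by
  induction s with
  | zero => simp
  | add s s' h h' => simp only [map_add, inner_add_left, h, h']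
  | tmul η f =>
    induction t with
    | zero => simp
    | add t t' h h' => simp only [map_add, inner_add_right, h, h']
    | tmul η' f' =>
      exact (lp.hasSum_inner (𝕜 := ℂ) (leftVec H ξ i hξ η f) (leftVec H ξ i hξ η' f')).unique
        (hasSum_leftCoord H ξ i hξ η η' f f')

/-- `V i` on the algebraic tensor product `H i ⊗ H(i)`, as a linear isometry. -/
noncomputable def leftIsometryAux (i : ι) (hξ : ‖ξ i‖ = 1) :
    H i ⊗[ℂ] SpaceAvoiding H ξ i →ₗᵢ[ℂ] Space H ξ :=
  (TensorProduct.lift (leftBilin H ξ i hξ)).isometryOfInner (inner_lift_leftBilin H ξ i hξ)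

/-- `V i : H i ⊗ H(i) → H` as a linear isometry. -/
noncomputable def leftIsometry (i : ι) (hξ : ‖ξ i‖ = 1) :
    HilbertTensor (H i) (SpaceAvoiding H ξ i) →ₗᵢ[ℂ] Space H ξ where
  toLinearMap := (leftIsometryAux H ξ i hξ).toContinuousLinearMap.fromCompletion.toLinearMap
  norm_map' x := by
    induction x using UniformSpace.Completion.induction_on with
    | hp =>
      exact isClosed_eq (ContinuousLinearMap.continuous _).norm continuous_norm
    | ih x =>
      simp

theorem leftIsometry_tmul (i : ι) (hξ : ‖ξ i‖ = 1) (η : H i) (f : SpaceAvoiding H ξ i) :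
    leftIsometry H ξ i hξ (HilbertTensor.tmul η f) = leftVec H ξ i hξ η f :=
  (leftIsometryAux H ξ i hξ).toContinuousLinearMap.fromCompletion_apply_coe _

theorem leftVec_single_incl (i : ι) (hξ : ‖ξ i‖ = 1) (l : WordAvoiding i)
    (t : WordSpace H ξ l.1) :
    leftVec H ξ i hξ (ξ i) (lp.single (E := fun l : WordAvoiding i => WordSpace H ξ l.1) 2 l t) =
      lp.single (E := fun l : Word ι => WordSpace H ξ l.1) 2 l.incl t := by
  refine Subtype.ext <| word_ext i (fun m => ?_) (fun m => ?_)
  · refine (leftCoord_incl H ξ i _ _ m).trans ?_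
    rw [inner_self_eq_norm_sq_to_K, hξ]
    by_cases hm : m = l
    · subst hm
      rw [lp.single_apply_self]
      simp
    · rw [lp.single_apply_ne _ _ _ hm, smul_zero]
      exact (lp.single_apply_ne (E := fun l : Word ι => WordSpace H ξ l.1) 2 l.incl t
        (WordAvoiding.incl_injective.ne hm)).symm
  · refine (leftCoord_cons H ξ i _ _ m).trans ?_
    have h0 : (Reduced H ξ i).orthogonalProjectionOnto (ξ i) = 0 :=
      Submodule.orthogonalProjectionOnto_orthogonal_apply_eq_zero
        (Submodule.mem_span_singleton_self (ξ i))
    rw [h0, zero_tmul]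
    exact (lp.single_apply_ne (E := fun l : Word ι => WordSpace H ξ l.1) 2 l.incl t
        (WordAvoiding.incl_ne_cons l m).symm).symm

theorem leftVec_single_cons (i : ι) (hξ : ‖ξ i‖ = 1) (l : WordAvoiding i) (θ : Reduced H ξ i)
    (t : WordSpace H ξ l.1) :
    leftVec H ξ i hξ θ (lp.single (E := fun l : WordAvoiding i => WordSpace H ξ l.1) 2 l t) =
      lp.single (E := fun l : Word ι => WordSpace H ξ l.1) 2 l.cons (tmul θ t) := by
  refine Subtype.ext <| word_ext i (fun m => ?_) (fun m => ?_)
  · refine (leftCoord_incl H ξ i _ _ m).trans ?_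
    have h0 : inner ℂ (ξ i) (θ : H i) = 0 := Submodule.mem_orthogonal_singleton_iff_inner_right.1 θ.2
    rw [h0, zero_smul]
    exact (lp.single_apply_ne (E := fun l : Word ι => WordSpace H ξ l.1) 2 l.cons (tmul θ t)
        (WordAvoiding.incl_ne_cons m l)).symm
  · refine (leftCoord_cons H ξ i _ _ m).trans ?_
    rw [Submodule.orthogonalProjectionOnto_mem_subspace_eq_self]
    by_cases hm : m = l
    · subst hm
      rw [lp.single_apply_self]
      exact (lp.single_apply_self (E := fun l : Word ι => WordSpace H ξ l.1) 2 m.cons _).symm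
    · rw [lp.single_apply_ne _ _ _ hm, tmul_zero]
      exact (lp.single_apply_ne (E := fun l : Word ι => WordSpace H ξ l.1) 2 l.cons (tmul θ t)
        (WordAvoiding.cons_injective.ne hm)).symm

theorem leftIsometry_surjective (i : ι) (hξ : ‖ξ i‖ = 1) :
    Function.Surjective (leftIsometry H ξ i hξ) := by
  let R : Submodule ℂ (Space H ξ) := LinearMap.range (leftIsometry H ξ i hξ).toLinearMap
  have hR : IsClosed (R : Set (Space H ξ)) :=
    (leftIsometry H ξ i hξ).isometry.isClosedEmbedding.isClosed_range
  have hsingle : ∀ (w : Word ι) (t : WordSpace H ξ w.1),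
      lp.single (E := fun l : Word ι => WordSpace H ξ l.1) 2 w t ∈ R := by
    intro w
    obtain ⟨l, rfl⟩ | ⟨l, rfl⟩ := w.eq_incl_or_eq_cons i
    · intro t
      exact ⟨_, (leftIsometry_tmul H ξ i hξ _ _).trans (leftVec_single_incl H ξ i hξ l t)⟩
    · let φ := lp.singleContinuousLinearMap ℂ (fun l : Word ι => WordSpace H ξ l.1) 2 l.cons
      refine mem_of_tmul_mem (R.comap φ.toLinearMap) (hR.preimage φ.continuous) fun θ t => ?_
      exact ⟨_, (leftIsometry_tmul H ξ i hξ _ _).trans (leftVec_single_cons H ξ i hξ l θ t)⟩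
  intro f
  exact hR.mem_of_tendsto (lp.hasSum_single (p := 2) (by simp) f)
    (Filter.Eventually.of_forall fun s => R.sum_mem fun l _ => hsingle l (f l))

/-- The unitary operator `V i : H i ⊗ H(i) → H`, with `ξ i ⊗ ζ ↦ ζ` and `θ ⊗ ζ ↦ θ ⊗ ζ` for `θ`
in `H° i`. -/
noncomputable def leftUnitary (i : ι) (hξ : ‖ξ i‖ = 1) :
    HilbertTensor (H i) (SpaceAvoiding H ξ i) ≃ₗᵢ[ℂ] Space H ξ :=
  LinearIsometryEquiv.ofSurjective (leftIsometry H ξ i hξ) (leftIsometry_surjective H ξ i hξ)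

/-- The operator `V i (x ⊗ 1) (V i)⋆` on the free product space, for an operator `x` on `H i`. -/
noncomputable def leftAction (i : ι) (hξ : ‖ξ i‖ = 1) (x : H i →L[ℂ] H i) :
    Space H ξ →L[ℂ] Space H ξ :=
  (leftUnitary H ξ i hξ).conjStarAlgEquiv
    (HilbertTensor.map x (ContinuousLinearMap.id ℂ (SpaceAvoiding H ξ i)))

end Space

end FreeProd

/-- A faithful tracial state: a positive linear functional with `τ 1 = 1`, `τ (ab) = τ (ba)`, and
`τ (a⋆a) = 0` only for `a = 0`. -/
structure IsFaithfulTracialState {A : Type*} [CStarAlgebra A] [PartialOrder A] [StarOrderedRing A]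
    (τ : A →ₚ[ℂ] ℂ) : Prop where
  map_one : τ 1 = 1
  map_mul_comm : ∀ a b : A, τ (a * b) = τ (b * a)
  faithful : ∀ a : A, τ (star a * a) = 0 → a = 0

/-- The cyclic vector of the GNS representation, the class of the unit. -/
noncomputable def gnsVector {A : Type*} [CStarAlgebra A] [PartialOrder A] [StarOrderedRing A]
    (τ : A →ₚ[ℂ] ℂ) : τ.GNS :=
  ((τ.toPreGNS 1 : τ.PreGNS) : UniformSpace.Completion τ.PreGNS)

theorem norm_gnsVector {A : Type*} [CStarAlgebra A] [PartialOrder A] [StarOrderedRing A]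
    (τ : A →ₚ[ℂ] ℂ) (hτ : τ 1 = 1) : ‖gnsVector τ‖ = 1 := by
  rw [gnsVector, UniformSpace.Completion.norm_coe, PositiveLinearMap.preGNS_norm_def]
  simp [hτ]

section ReducedFreeProduct

variable {ι : Type} [DecidableEq ι] {A : ι → Type u} [∀ i, CStarAlgebra (A i)]
  [∀ i, PartialOrder (A i)] [∀ i, StarOrderedRing (A i)]

/-- The Hilbert space free product of the GNS spaces of the states `τ i`. -/
abbrev FreeGNS (τ : ∀ i, A i →ₚ[ℂ] ℂ) : Type u :=
  FreeProd.Space (fun i => (τ i).GNS) (fun i => gnsVector (τ i))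

/-- The representation `a ↦ V i (π i a ⊗ 1) (V i)⋆` of `A i` on the free product Hilbert space,
where `π i` is the GNS representation of the state `τ i`. -/
noncomputable def freeRep (τ : ∀ i, A i →ₚ[ℂ] ℂ) (hτ : ∀ i, τ i 1 = 1) (i : ι) (a : A i) :
    FreeGNS τ →L[ℂ] FreeGNS τ :=
  FreeProd.leftAction (fun i => (τ i).GNS) (fun i => gnsVector (τ i)) i
    (norm_gnsVector (τ i) (hτ i)) ((τ i).gnsStarAlgHom a)

/-- The reduced free product of the `C⋆`-algebras `A i` with respect to the states `τ i`: the
`C⋆`-algebra of operators on the free product Hilbert space generated by the images of all `A i`. -/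
noncomputable def reducedFreeProduct (τ : ∀ i, A i →ₚ[ℂ] ℂ) (hτ : ∀ i, τ i 1 = 1) :
    StarSubalgebra ℂ (FreeGNS τ →L[ℂ] FreeGNS τ) :=
  (StarAlgebra.adjoin ℂ (⋃ i, Set.range (freeRep τ hτ i))).topologicalClosure

instance (τ : ∀ i, A i →ₚ[ℂ] ℂ) (hτ : ∀ i, τ i 1 = 1) :
    IsClosed (reducedFreeProduct τ hτ : Set (FreeGNS τ →L[ℂ] FreeGNS τ)) :=
  StarSubalgebra.isClosed_topologicalClosure _

end ReducedFreeProduct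

/-- A separable `C⋆`-algebra `A` is quasidiagonal if it has a faithful `⋆`-representation `π` on a
Hilbert space `K` for which there is an increasing sequence of finite-rank projections `p n` on `K`
tending strongly to the identity with `‖π a * p n - p n * π a‖ → 0` for all `a`. -/
def IsQuasidiagonal (A : Type u) [NonUnitalCStarAlgebra A] : Prop :=
  ∃ (K : Type w) (_ : NormedAddCommGroup K) (_ : InnerProductSpace ℂ K) (_ : CompleteSpace K)
    (π : A →⋆ₙₐ[ℂ] (K →L[ℂ] K)) (p : ℕ → K →L[ℂ] K),
    Function.Injective π ∧
    (∀ n, IsStarProjection (p n)) ∧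
    (∀ n, FiniteDimensional ℂ (LinearMap.range (p n).toLinearMap)) ∧
    Monotone p ∧
    (∀ x, Tendsto (fun n => p n x) atTop (𝓝 x)) ∧
    ∀ a, Tendsto (fun n => ‖π a * p n - p n * π a‖) atTop (𝓝 0)

/-! ### Square-root norm bounds from orthogonal projections. -/

section OrthogonalProjections

variable {B ι : Type*} [NonUnitalCStarAlgebra B] [Fintype ι]

/-- Orthogonality kills the cross terms of `X * star X` for the sum `X`, leaving `∑ x i * e i * star
(x i)`, which has at most `card ι` terms' worth of norm `C ^ 2`. -/
theorem norm_sum_mul_projection_le {e x : ι → B} {C : ℝ} (hC : 0 ≤ C)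
    (he : ∀ i, IsStarProjection (e i)) (horth : Pairwise fun i j => e i * e j = 0)
    (hx : ∀ i, ‖x i‖ ≤ C) : ‖∑ i, x i * e i‖ ≤ C * √(Fintype.card ι) := by
  refine abs_le_of_sq_le_sq' ?_ (by positivity) |>.2
  have h : (∑ i, x i * e i) * star (∑ i, x i * e i) = ∑ i, x i * e i * star (x i) := by
    rw [star_sum, Finset.sum_mul_sum]
    refine Finset.sum_congr rfl fun i _ => ?_
    rw [Finset.sum_eq_single i]
    · rw [star_mul, (he i).isSelfAdjoint.star_eq, ← mul_assoc, mul_assoc (x i),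
        (he i).isIdempotentElem.eq]
    · intro j _ hj
      rw [star_mul, (he j).isSelfAdjoint.star_eq, ← mul_assoc, mul_assoc (x i), horth hj.symm]
      simp
    · simp
  rw [sq, ← CStarRing.norm_self_mul_star, h]
  calc ‖∑ i, x i * e i * star (x i)‖ ≤ ∑ i : ι, C * 1 * C := by
        refine norm_sum_le_of_le _ fun i _ => ?_
        refine (norm_mul_le _ _).trans ?_
        rw [norm_star]
        gcongr
        · exact (norm_mul_le _ _).trans
            (mul_le_mul (hx i) ((he i).norm_le) (norm_nonneg _) hC)
        · exact hx i
    _ = (C * √(Fintype.card ι)) ^ 2 := by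
        rw [mul_pow, Real.sq_sqrt (by positivity)]
        simp
        ring

/-- Split `y i` into `y i * e i` and a remainder absorbed by `e i` on the left. The first parts form
a row handled by the previous bound, the second parts its adjoint version. -/
theorem norm_sum_le_of_projections {e y : ι → B}
    (he : ∀ i, IsStarProjection (e i)) (horth : Pairwise fun i j => e i * e j = 0)
    (hy : ∀ i, ‖y i‖ ≤ 1) (hye : ∀ i, y i - y i * e i = e i * (y i - y i * e i)) :
    ‖∑ i, y i‖ ≤ 3 * √(Fintype.card ι) := by
  have h₁ := norm_sum_mul_projection_le zero_le_one he horth hy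
  -- The triangle inequality gives the crude bound `2` here, since no unit is assumed; this makes
  -- the final constant `1 + 2 = 3`.
  have hn : ∀ i, ‖star (y i - y i * e i)‖ ≤ 2 := fun i => by
    rw [norm_star]
    refine (norm_sub_le _ _).trans ?_
    have := (norm_mul_le (y i) (e i)).trans
      (mul_le_mul (hy i) ((he i).norm_le) (norm_nonneg _) zero_le_one)
    linarith [hy i]
  have h₂ := norm_sum_mul_projection_le zero_le_two he horth hn
  have h₃ : ∑ i, y i = ∑ i, y i * e i + star (∑ i, star (y i - y i * e i) * e i) := by
    rw [star_sum, ← Finset.sum_add_distrib]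
    refine Finset.sum_congr rfl fun i _ => ?_
    rw [star_mul, star_star, (he i).isSelfAdjoint.star_eq, ← hye]
    abel
  rw [h₃]
  refine (norm_add_le _ _).trans ?_
  rw [norm_star]
  linarith

end OrthogonalProjections

/-! ### Orthogonal projections from Avitzour's relations, in an abstract star ring. -/

section Avitzour

variable {R : Type*} [Ring R] {P a b c : R}

theorem mul_eq_projection_mul_of_projection_mul_eq_zero (ha : (1 - P) * a * (1 - P) = 0) {x : R}
    (hx : P * x = 0) : a * x = P * (a * x) := by
  have hx' : (1 - P) * x = x := by rw [sub_mul, one_mul, hx, sub_zero]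
  have h : (1 - P) * a * (1 - P) * x = 0 := by rw [ha, zero_mul]
  rw [mul_assoc, hx', mul_assoc, sub_mul, one_mul, sub_eq_zero] at h
  exact h

/-- Ping-pong: if `P * x = 0`, then `a` sends `x` into the range of `P`, and `c` sends that range
back into the kernel of `P`. The factor `b * P` starts the alternation. -/
theorem projection_mul_pow_mul_projection (hb : P * b * P = 0) (hc : P * c * P = 0)
    (ha : (1 - P) * a * (1 - P) = 0) (n : ℕ) : P * ((c * a) ^ n * b * P) = 0 := by
  induction n with
  | zero => simpa [mul_assoc] using hb
  | succ n ih =>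
    rw [pow_succ', mul_assoc (c * a), mul_assoc (c * a), mul_assoc c,
      mul_eq_projection_mul_of_projection_mul_eq_zero ha ih, ← mul_assoc, ← mul_assoc, hc,
      zero_mul]

variable [StarRing R]

/-- This is the orthogonality of `e i` and `e j` for `i < j`, once the common power of `c * a` has
cancelled. The alternation ends with `star b * c` in place of `c`, hence the third relation. -/
theorem projection_mul_star_mul_pow_succ_mul_projection (hb : P * b * P = 0) (hc : P * c * P = 0)
    (hbc : P * (star b * c) * P = 0) (ha : (1 - P) * a * (1 - P) = 0) (n : ℕ) :
    P * (star b * (c * a) ^ (n + 1) * b) * P = 0 := by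
  have h := projection_mul_pow_mul_projection hb hc ha n
  calc P * (star b * (c * a) ^ (n + 1) * b) * P
      = P * (star b * c) * (a * ((c * a) ^ n * b * P)) := by
        rw [pow_succ']
        simp only [mul_assoc]
    _ = 0 := by
        rw [mul_eq_projection_mul_of_projection_mul_eq_zero ha h, ← mul_assoc, hbc, zero_mul]

theorem star_mul_pow_mul_pow_add_mul (h : star (c * a) * (c * a) = 1) (n d : ℕ) :
    star ((c * a) ^ n * b) * ((c * a) ^ (n + d) * b) = star b * (c * a) ^ d * b := by
  have hn : star ((c * a) ^ n) * (c * a) ^ n = 1 := by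
    induction n with
    | zero => simp
    | succ n ih =>
      rw [pow_succ', star_mul, mul_assoc, ← mul_assoc (star (c * a)), h, one_mul, ih]
  rw [star_mul, pow_add]
  simp only [mul_assoc]
  rw [← mul_assoc (star ((c * a) ^ n)), hn, one_mul]

/-- Pairwise orthogonal projections `e n` such that the conjugate of `a` by the `n`-th unitary
`(c * a) ^ n * b` maps the complement of the range of `e n` into the range of `e n`. -/
theorem exists_projections_of_avitzour (hP : IsStarProjection P)
    (hau : a ∈ unitary R) (hbu : b ∈ unitary R) (hcu : c ∈ unitary R)
    (hb : P * b * P = 0) (hc : P * c * P = 0) (hbc : P * (star b * c) * P = 0)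
    (ha : (1 - P) * a * (1 - P) = 0) :
    ∃ e : ℕ → R, (∀ n, IsStarProjection (e n)) ∧ (Pairwise fun i j => e i * e j = 0) ∧
      ∀ n, e n * ((c * a) ^ n * b * a * star ((c * a) ^ n * b) * (1 - e n)) =
        (c * a) ^ n * b * a * star ((c * a) ^ n * b) * (1 - e n) := by
  set g : ℕ → R := fun n => (c * a) ^ n * b with hg
  have hgu : ∀ n, g n ∈ unitary R := fun n => mul_mem (pow_mem (mul_mem hcu hau) n) hbu
  have hg1 : ∀ n, star (g n) * g n = 1 := fun n => (Unitary.mem_iff.1 (hgu n)).1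
  have hst : ∀ n x, star (g n) * (g n * x) = x := fun n x => by
    rw [← mul_assoc, hg1, one_mul]
  have hlt : ∀ i j, i < j → P * (star (g i) * g j) * P = 0 := fun i j hij => by
    obtain ⟨d, rfl⟩ := Nat.exists_eq_add_of_lt hij
    simp only [hg]
    rw [add_assoc, star_mul_pow_mul_pow_add_mul (Unitary.mem_iff.1 (mul_mem hcu hau)).1]
    exact projection_mul_star_mul_pow_succ_mul_projection hb hc hbc ha d
  have hne : ∀ i j, i ≠ j → P * (star (g i) * g j) * P = 0 := fun i j hij => by
    rcases hij.lt_or_gt with h | h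
    · exact hlt i j h
    · have := congrArg star (hlt j i h)
      simpa [hP.isSelfAdjoint.star_eq, mul_assoc] using this
  refine ⟨fun n => g n * P * star (g n), fun n => ⟨?_, ?_⟩, fun i j hij => ?_, fun n => ?_⟩
  · change g n * P * star (g n) * (g n * P * star (g n)) = g n * P * star (g n)
    simp only [mul_assoc, hst]
    rw [← mul_assoc P P, hP.isIdempotentElem.eq]
  · simp [IsSelfAdjoint, hP.isSelfAdjoint.star_eq, mul_assoc]
  · calc g i * P * star (g i) * (g j * P * star (g j))
        = g i * (P * (star (g i) * g j) * P) * star (g j) := by simp only [mul_assoc]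
      _ = 0 := by rw [hne i j hij, mul_zero, zero_mul]
  -- Conjugation by `g n` reduces the claim to `a * (1 - P) = P * (a * (1 - P))`.
  · have h1 : g n * a * star (g n) * (1 - g n * P * star (g n)) =
        g n * (a * (1 - P)) * star (g n) := by
      rw [mul_sub]
      simp only [mul_assoc, hst]
      noncomm_ring
    have h2 : a * (1 - P) = P * (a * (1 - P)) :=
      mul_eq_projection_mul_of_projection_mul_eq_zero ha hP.mul_one_sub_self
    change g n * P * star (g n) * (g n * a * star (g n) * (1 - g n * P * star (g n))) =
      g n * a * star (g n) * (1 - g n * P * star (g n))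
    rw [h1, ← mul_assoc _ (g n * (a * (1 - P)))]
    nth_rw 2 [h2]
    simp only [mul_assoc, hst]

end Avitzour

/-! ### Matrix amplifications and contractive coefficient matrices. -/

section Amplification

variable {A H J : Type*} [NonUnitalCStarAlgebra A] [NormedAddCommGroup H] [InnerProductSpace ℂ H]
  [Fintype J]

/-- The operator on `Hⁿ` given by a matrix of operators on `H`. -/
noncomputable def matrixOperator (T : J → J → H →L[ℂ] H) :
    PiLp 2 (fun _ : J => H) →L[ℂ] PiLp 2 (fun _ : J => H) :=
  (PiLp.continuousLinearEquiv 2 ℂ (fun _ : J => H)).symm.toContinuousLinearMap ∘L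
    ContinuousLinearMap.pi fun i => ∑ j, T i j ∘L PiLp.proj 2 (fun _ : J => H) j

theorem matrixOperator_apply (T : J → J → H →L[ℂ] H) (ζ : PiLp 2 (fun _ : J => H)) (i : J) :
    matrixOperator T ζ i = ∑ j, T i j (ζ j) := by
  simp [matrixOperator]

theorem inner_matrixOperator (T : J → J → H →L[ℂ] H) (ζ η : PiLp 2 (fun _ : J => H)) :
    inner ℂ ζ (matrixOperator T η) = ∑ i, ∑ j, inner ℂ (ζ i) (T i j (η j)) := by
  simp only [PiLp.inner_apply, matrixOperator_apply, inner_sum]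

variable [CompleteSpace H]

/-- The amplification of a representation of `A` on `H` to a representation of the matrices over `A`
on `Hⁿ`. -/
noncomputable def amplification (f : A →⋆ₙₐ[ℂ] (H →L[ℂ] H)) :
    CStarMatrix J J A →⋆ₙₐ[ℂ] (PiLp 2 (fun _ : J => H) →L[ℂ] PiLp 2 (fun _ : J => H)) where
  toFun M := matrixOperator fun i j => f (M i j)
  map_smul' c M := by
    ext ζ i
    simp [matrixOperator_apply, Finset.smul_sum]
  map_zero' := by
    ext ζ i
    simp [matrixOperator_apply]
  map_add' M N := by
    ext ζ i
    simp [matrixOperator_apply, Finset.sum_add_distrib]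
  map_mul' M N := by
    ext ζ i
    simp only [matrixOperator_apply, CStarMatrix.mul_apply, map_sum, map_mul,
      mul_apply_eq_comp, sum_apply]
    exact Finset.sum_comm
  map_star' M := by
    refine (ContinuousLinearMap.eq_adjoint_iff _ _).2 fun ζ η => ?_
    rw [inner_matrixOperator, ← inner_conj_symm, inner_matrixOperator, map_sum]
    simp only [map_sum, inner_conj_symm]
    rw [Finset.sum_comm]
    refine Finset.sum_congr rfl fun i _ => Finset.sum_congr rfl fun j _ => ?_
    rw [CStarMatrix.star_apply, map_star, ContinuousLinearMap.star_eq_adjoint,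
      ContinuousLinearMap.adjoint_inner_left]

theorem amplification_apply (f : A →⋆ₙₐ[ℂ] (H →L[ℂ] H)) (M : CStarMatrix J J A) :
    amplification f M = matrixOperator fun i j => f (M i j) := rfl

theorem amplification_injective {f : A →⋆ₙₐ[ℂ] (H →L[ℂ] H)} (hf : Function.Injective f) :
    Function.Injective (amplification (J := J) f) := by
  classical
  refine (injective_iff_map_eq_zero _).2 fun M hM => ?_
  ext i j
  refine hf ?_
  ext x
  have := congrArg (fun T => T (PiLp.single 2 j x) i) hM
  simp only [amplification_apply, matrixOperator_apply] at this
  rw [Finset.sum_eq_single j] at this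
  · simpa using this
  · intro k _ hk
    simp [hk]
  · simp

/-- The double sum is a quadratic form of the amplified operator at the vector `(ζ j)`, whose
squared norm is `card J`; star homomorphisms are contractive. -/
theorem norm_inner_matrixOperator_le [PartialOrder A] [StarOrderedRing A]
    (f : A →⋆ₙₐ[ℂ] (H →L[ℂ] H)) (M : CStarMatrix J J A)
    (ζ : J → H) (hζ : ∀ j, ‖ζ j‖ = 1) :
    ‖∑ i, ∑ j, inner ℂ (ζ i) (f (M i j) (ζ j))‖ ≤ ‖M‖ * Fintype.card J := by
  have h := inner_matrixOperator (fun i j => f (M i j)) (WithLp.toLp 2 ζ) (WithLp.toLp 2 ζ)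
  have hn : ‖WithLp.toLp 2 ζ‖ ^ 2 = Fintype.card J := by
    rw [PiLp.norm_sq_eq_of_L2]
    simp [hζ]
  rw [← amplification_apply] at h
  change ‖∑ i, ∑ j, inner ℂ (WithLp.toLp 2 ζ i) (f (M i j) (WithLp.toLp 2 ζ j))‖ ≤ _
  rw [← h, ← hn]
  refine (norm_inner_le_norm _ _).trans ?_
  have h1 := (amplification f M).le_of_opNorm_le
    (NonUnitalStarAlgHom.norm_apply_le (amplification f) M) (WithLp.toLp 2 ζ)
  nlinarith [norm_nonneg (WithLp.toLp 2 ζ),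
    mul_le_mul_of_nonneg_left h1 (norm_nonneg (WithLp.toLp 2 ζ))]

/-- A complex matrix that is a contraction of `ℓ²` is a contraction of the matrix `C⋆`-algebra. -/
theorem cstarMatrix_norm_le_one {M : CStarMatrix J J ℂ}
    (h : ∀ x : J → ℂ, ∑ i, ‖∑ j, M i j * x j‖ ^ 2 ≤ ∑ j, ‖x j‖ ^ 2) : ‖M‖ ≤ 1 := by
  let f : ℂ →⋆ₙₐ[ℂ] (ℂ →L[ℂ] ℂ) :=
    ((StarAlgHom.ofId ℂ (ℂ →L[ℂ] ℂ) : ℂ →⋆ₐ[ℂ] (ℂ →L[ℂ] ℂ)) : ℂ →⋆ₙₐ[ℂ] (ℂ →L[ℂ] ℂ))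
  have hfa : ∀ c x : ℂ, f c x = c * x := fun c x => by
    change (algebraMap ℂ (ℂ →L[ℂ] ℂ) c) x = _
    simp [Algebra.algebraMap_eq_smul_one]
  have hf : Function.Injective f := fun c d hcd => by
    have := congrArg (fun T => T 1) hcd
    simpa [hfa] using this
  rw [← NonUnitalStarAlgHom.norm_map _ (amplification_injective (J := J) hf)]
  refine ContinuousLinearMap.opNorm_le_bound _ zero_le_one fun x => ?_
  rw [one_mul]
  refine le_of_sq_le_sq ?_ (norm_nonneg _)
  rw [PiLp.norm_sq_eq_of_L2, PiLp.norm_sq_eq_of_L2]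
  simp only [amplification_apply, matrixOperator_apply, hfa]
  exact h x

/-- Bessel's inequality: the matrix of a contraction with respect to an orthonormal family is a
contraction. -/
theorem norm_conj_matrix_le_one {H : Type*} [NormedAddCommGroup H] [InnerProductSpace ℂ H]
    {f : J → H} (hf : Orthonormal ℂ f) {T : H →L[ℂ] H} (hT : ‖T‖ ≤ 1) :
    ‖(CStarMatrix.ofMatrix (Matrix.of fun i j => inner ℂ (T (f j)) (f i)) :
      CStarMatrix J J ℂ)‖ ≤ 1 := by
  refine cstarMatrix_norm_le_one fun x => ?_
  -- The entries are conjugates of those of the compression of `T`, so the coefficients of the test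
  -- vector are conjugated too.
  set y : H := ∑ j, star (x j) • f j
  have hy : ‖y‖ ^ 2 = ∑ j, ‖x j‖ ^ 2 := by
    have h := hf.inner_sum (fun j => star (x j)) (fun j => star (x j)) Finset.univ
    rw [inner_self_eq_norm_sq_to_K] at h
    have h2 : ((‖y‖ ^ 2 : ℝ) : ℂ) = ((∑ j, ‖x j‖ ^ 2 : ℝ) : ℂ) := by
      push_cast
      rw [show (‖y‖ : ℂ) ^ 2 = _ from h]
      refine Finset.sum_congr rfl fun j _ => ?_
      simp [Complex.mul_conj, Complex.normSq_eq_norm_sq]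
    exact_mod_cast h2
  have hxy : ∀ i, ∑ j, inner ℂ (T (f j)) (f i) * x j = inner ℂ (T y) (f i) := fun i => by
    simp [y, mul_comm]
  rw [← hy]
  calc ∑ i, ‖∑ j, inner ℂ (T (f j)) (f i) * x j‖ ^ 2 = ∑ i, ‖inner ℂ (f i) (T y)‖ ^ 2 := by
        refine Finset.sum_congr rfl fun i _ => ?_
        rw [hxy, norm_inner_symm]
    _ ≤ ‖T y‖ ^ 2 := hf.sum_inner_products_le _
    _ ≤ ‖y‖ ^ 2 := by
        gcongr
        simpa using T.le_of_opNorm_le hT y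

end Amplification

/-! ### Almost invariant finite orthonormal families. -/

section Quasidiagonal

variable {K : Type*} [NormedAddCommGroup K] [InnerProductSpace ℂ K] [CompleteSpace K]

theorem IsStarProjection.inner_apply_left {p : K →L[ℂ] K} (hp : IsStarProjection p) (x y : K) :
    inner ℂ (p x) y = inner ℂ x (p y) := by
  rw [← ContinuousLinearMap.adjoint_inner_right, ← ContinuousLinearMap.star_eq_adjoint,
    hp.isSelfAdjoint.star_eq]

theorem IsStarProjection.apply_apply {p : K →L[ℂ] K} (hp : IsStarProjection p) (x : K) :
    p (p x) = p x :=
  congrArg (fun T => T x) hp.isIdempotentElem.eq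

theorem IsStarProjection.norm_apply_sq_add {p : K →L[ℂ] K} (hp : IsStarProjection p) (x : K) :
    ‖p x‖ ^ 2 + ‖x - p x‖ ^ 2 = ‖x‖ ^ 2 := by
  have h : inner ℂ (p x) (x - p x) = 0 := by
    rw [hp.inner_apply_left, map_sub, hp.apply_apply, sub_self, inner_zero_right]
  have := norm_add_sq_eq_norm_sq_add_norm_sq_of_inner_eq_zero _ _ h
  rw [add_sub_cancel] at this
  linarith

theorem IsStarProjection.norm_apply_le {p : K →L[ℂ] K} (hp : IsStarProjection p) (x : K) :
    ‖p x‖ ≤ ‖x‖ := by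
  simpa using p.le_of_opNorm_le (hp.norm_le) x

/-- Diagonalization of the compression of a projection `q` to the range of `p`. -/
theorem IsStarProjection.exists_orthonormal_eigenvectors {p q : K →L[ℂ] K}
    (hp : IsStarProjection p) (hq : IsStarProjection q)
    (hfin : FiniteDimensional ℂ (LinearMap.range p.toLinearMap)) :
    ∃ (n : ℕ) (f : Fin n → K) (ev : Fin n → ℝ), Orthonormal ℂ f ∧ (∀ j, p (f j) = f j) ∧
      (∀ j, p (q (f j)) = (ev j : ℂ) • f j) ∧
      ∀ x, ∑ j, ‖inner ℂ (f j) x‖ ^ 2 = ‖p x‖ ^ 2 := by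
  let E := LinearMap.range p.toLinearMap
  have hE : ∀ x : E, p x = x := by
    rintro ⟨_, x, rfl⟩
    exact hp.apply_apply x
  let T : E →ₗ[ℂ] E := p.toLinearMap.rangeRestrict ∘ₗ q.toLinearMap ∘ₗ E.subtype
  have hT : T.IsSymmetric := fun x y => by
    change inner ℂ (p (q x)) (y : K) = inner ℂ (x : K) (p (q y))
    rw [hp.inner_apply_left, hE, hq.inner_apply_left, ← hp.inner_apply_left (x : K), hE]
  let b := hT.eigenvectorBasis rfl
  refine ⟨_, fun j => (b j : K), hT.eigenvalues rfl, ?_, fun j => hE _, fun j => ?_, fun x => ?_⟩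
  · exact b.orthonormal.comp_linearIsometry E.subtypeₗᵢ
  · exact congrArg Subtype.val (hT.apply_eigenvectorBasis rfl j)
  · refine Eq.trans ?_ (b.sum_sq_norm_inner_right ⟨p x, x, rfl⟩)
    refine Finset.sum_congr rfl fun j _ => ?_
    change _ = ‖inner ℂ (b j : K) (p x)‖ ^ 2
    rw [← hp.inner_apply_left, hE]

/-- Here `q` is the image of the unit, possibly not the identity. Since `p` and `q` almost commute,
a diagonalizing basis for the compression of `q` to the range of `p` is usable after discarding the
eigenvectors with eigenvalue below `1 / 2`: those are nearly orthogonal to the part of the range of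
`q` that `p` almost fixes. -/
theorem exists_orthonormal_of_commutator_le {ι : Type*} {p q : K →L[ℂ] K}
    (hp : IsStarProjection p) (hq : IsStarProjection q)
    (hfin : FiniteDimensional ℂ (LinearMap.range p.toLinearMap))
    {T : ι → K →L[ℂ] K} (hT : ∀ i, star (T i) * T i = q) (hqT : ∀ i, q * T i = T i)
    {δ : ℝ} (hqp : ‖q * p - p * q‖ ≤ δ) (hTp : ∀ i, ‖T i * p - p * T i‖ ≤ δ)
    {x : K} (hx : ‖x‖ = 1) (hqx : q x = x) (hpx : ‖p x - x‖ ≤ 1 / 10) :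
    ∃ (J : Type) (_ : Fintype J) (_ : Nonempty J) (f : J → K), Orthonormal ℂ f ∧
      ∀ i b, 1 - 7 * δ ^ 2 ≤ ∑ a, ‖inner ℂ (f a) (T i (f b))‖ ^ 2 := by
  obtain ⟨n, f, ev, hf, hpf, hev, hsum⟩ := hp.exists_orthonormal_eigenvectors hq hfin
  have hnorm : ∀ j, ‖q (f j)‖ ^ 2 = ev j := fun j => by
    have h : inner ℂ (q (f j)) (q (f j)) = ((ev j : ℝ) : ℂ) := by
      rw [hq.inner_apply_left, hq.apply_apply]
      nth_rw 1 [← hpf j]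
      rw [hp.inner_apply_left, hev, inner_smul_right, inner_self_eq_norm_sq_to_K, hf.norm_eq_one]
      simp
    rw [← inner_self_eq_norm_sq (𝕜 := ℂ), h]
    simp
  have hsub : ∀ (S : K →L[ℂ] K), ‖S * p - p * S‖ ≤ δ →
      ∀ j, ‖S (f j) - p (S (f j))‖ ^ 2 ≤ δ ^ 2 := by
    intro S hS j
    have h := (S * p - p * S).le_of_opNorm_le hS (f j)
    rw [hf.norm_eq_one, mul_one] at h
    change ‖S (p (f j)) - p (S (f j))‖ ≤ δ at h
    rw [hpf] at h
    gcongr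
  -- Pythagoras for `q (f j)` reads `ev j - ev j ^ 2 ≤ δ ^ 2`; divide by `ev j ≥ 1 / 2`.
  have hev1 : ∀ j, 1 / 2 ≤ ev j → 1 - 2 * δ ^ 2 ≤ ev j := fun j hj => by
    have h1 := hp.norm_apply_sq_add (q (f j))
    have h2 := hsub q hqp j
    rw [hev] at h2
    rw [hnorm, hev, norm_smul, hf.norm_eq_one, mul_one, Complex.norm_real, Real.norm_eq_abs,
      sq_abs] at h1
    have h3 : ev j ≤ 1 := by
      rw [← hnorm, sq_le_one_iff₀ (norm_nonneg _)]
      exact (hq.norm_apply_le _).trans_eq (hf.norm_eq_one j)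
    nlinarith
  -- The coefficient of `q (y - p y)` along `f j` is `1 - ev j` times that of `y`, and `1 - ev j > 1
  -- / 2` on the discarded indices; Bessel's inequality then bounds their total mass.
  have hsmall : ∀ y, q y = y →
      ∑ j with ¬ 1 / 2 ≤ ev j, ‖inner ℂ (f j) y‖ ^ 2 ≤ 4 * ‖y - p y‖ ^ 2 := fun y hy => by
    have h1 : ∀ j, inner ℂ (f j) (q (y - p y)) = ((1 - ev j : ℝ) : ℂ) * inner ℂ (f j) y :=
      fun j => by
        rw [map_sub, hy, inner_sub_right, ← hq.inner_apply_left, ← hp.inner_apply_left, hev,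
          inner_smul_left]
        simp
        ring
    calc ∑ j with ¬ 1 / 2 ≤ ev j, ‖inner ℂ (f j) y‖ ^ 2
        ≤ ∑ j with ¬ 1 / 2 ≤ ev j, 4 * ‖inner ℂ (f j) (q (y - p y))‖ ^ 2 := by
          refine Finset.sum_le_sum fun j hj => ?_
          have hj' := (Finset.mem_filter.1 hj).2
          rw [h1, norm_mul, Complex.norm_real, Real.norm_eq_abs, mul_pow, sq_abs]
          have : 1 ≤ 4 * (1 - ev j) ^ 2 := by nlinarith
          nlinarith [sq_nonneg ‖inner ℂ (f j) y‖]
      _ ≤ ∑ j, 4 * ‖inner ℂ (f j) (q (y - p y))‖ ^ 2 :=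
          Finset.sum_le_sum_of_subset_of_nonneg (Finset.filter_subset _ _)
            fun _ _ _ => by positivity
      _ ≤ 4 * ‖y - p y‖ ^ 2 := by
          rw [← Finset.mul_sum]
          gcongr
          refine (hf.sum_inner_products_le _).trans ?_
          gcongr
          exact hq.norm_apply_le _
  have hsplit : ∀ y, ∑ j with 1 / 2 ≤ ev j, ‖inner ℂ (f j) y‖ ^ 2 +
      ∑ j with ¬ 1 / 2 ≤ ev j, ‖inner ℂ (f j) y‖ ^ 2 = ‖p y‖ ^ 2 := fun y => by
    rw [← hsum, Finset.sum_filter_add_sum_filter_not]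
  have hsubtype : ∀ y, ∑ j : {j // 1 / 2 ≤ ev j}, ‖inner ℂ (f j) y‖ ^ 2 =
      ∑ j with 1 / 2 ≤ ev j, ‖inner ℂ (f j) y‖ ^ 2 := fun y =>
    (Finset.sum_subtype _ (fun j => by simp) fun j => ‖inner ℂ (f j) y‖ ^ 2).symm
  refine ⟨{j // 1 / 2 ≤ ev j}, inferInstance, ?_, fun j => f j,
    hf.comp _ Subtype.val_injective, fun i b => ?_⟩
  -- If every eigenvector were discarded, `‖p x‖ ^ 2` would be at most `4 / 100`, although `p`
  -- almost fixes the unit vector `x`.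
  · by_contra hempty
    rw [not_nonempty_iff] at hempty
    have h1 := hsplit x
    rw [← hsubtype, Finset.univ_eq_empty, Finset.sum_empty, zero_add] at h1
    have h2 := hsmall x hqx
    have h3 := hp.norm_apply_sq_add x
    rw [norm_sub_rev] at hpx
    have h4 : ‖x - p x‖ ^ 2 ≤ (1 / 10) ^ 2 := by gcongr
    rw [hx] at h3
    linarith
  · have h0 : ‖T i (f b)‖ ^ 2 = ev b := by
      rw [← hnorm]
      have h : inner ℂ (T i (f b)) (T i (f b)) = inner ℂ (q (f b)) (q (f b)) := by
        rw [hq.inner_apply_left, hq.apply_apply, ← hT i]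
        exact (ContinuousLinearMap.adjoint_inner_right _ _ _).symm
      rw [inner_self_eq_norm_sq_to_K, inner_self_eq_norm_sq_to_K] at h
      exact_mod_cast h
    have h1 := hsplit (T i (f b))
    have h2 := hsmall (T i (f b)) (congrArg (fun S => S (f b)) (hqT i))
    have h3 := hp.norm_apply_sq_add (T i (f b))
    have h4 := hsub (T i) (hTp i) b
    have h5 := hev1 b b.2
    rw [hsubtype]
    -- The loss `7 * δ ^ 2` is `2` from the norm of `T i (f b)`, `1` from leaving the range of `p`,
    -- and `4` from the discarded eigenvectors.
    linarith

end Quasidiagonal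

/-- A quasidiagonal unital `C⋆`-algebra has a faithful representation with, for any finite family
of isometries, a finite orthonormal family whose span is almost invariant under them. -/
theorem IsQuasidiagonal.exists_orthonormal {A : Type u} [CStarAlgebra A] [Nontrivial A]
    (h : IsQuasidiagonal.{u, w} A) {ι : Type*} [Finite ι] {v : ι → A}
    (hv : ∀ i, star (v i) * v i = 1) :
    ∃ (K : Type w) (_ : NormedAddCommGroup K) (_ : InnerProductSpace ℂ K) (_ : CompleteSpace K)
      (π : A →⋆ₙₐ[ℂ] (K →L[ℂ] K)) (J : Type) (_ : Fintype J) (_ : Nonempty J) (f : J → K),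
      Orthonormal ℂ f ∧
      ∀ i b, 9 / 10 ≤ ∑ a, ‖inner ℂ (f a) (π (v i) (f b))‖ ^ 2 := by
  obtain ⟨K, _, _, _, π, p, hπ, hp, hfin, -, hlim, hcomm⟩ := h
  have hq : IsStarProjection (π 1) := IsStarProjection.map (IsStarProjection.one A) π
  have hq0 : π 1 ≠ 0 := fun h => one_ne_zero (hπ (h.trans (map_zero π).symm))
  obtain ⟨x, hx, hqx⟩ : ∃ x : K, ‖x‖ = 1 ∧ π 1 x = x := by
    obtain ⟨y, hy⟩ : ∃ y, π 1 y ≠ 0 := by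
      by_contra! h0
      exact hq0 (ContinuousLinearMap.ext h0)
    refine ⟨((‖π 1 y‖ : ℂ)⁻¹) • π 1 y, ?_, ?_⟩
    · rw [norm_smul]
      simp [hy]
    · rw [map_smul, hq.apply_apply]
  have hev : ∀ a, ∀ᶠ n in atTop, ‖π a * p n - p n * π a‖ ≤ 1 / 10 := fun a =>
    (hcomm a).eventually_le_const (by norm_num)
  have hevx : ∀ᶠ n in atTop, ‖p n x - x‖ ≤ 1 / 10 := by
    have h := ((hlim x).sub_const x).norm
    rw [sub_self, norm_zero] at h
    exact h.eventually_le_const (by norm_num)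
  obtain ⟨n, hn1, hn2, hnx⟩ :=
    ((hev 1).and ((eventually_all.2 fun i => hev (v i)).and hevx)).exists
  obtain ⟨J, hJ, hJ', f, hf, hfs⟩ := exists_orthonormal_of_commutator_le (T := fun i => π (v i))
    (hp n) hq (hfin n) (fun i => by rw [← map_star, ← map_mul, hv])
    (fun i => by rw [← map_mul, one_mul]) hn1 hn2 hx hqx hnx
  refine ⟨K, _, _, inferInstance, π, J, hJ, hJ', f, hf, fun i b => le_trans ?_ (hfs i b)⟩
  -- With `δ = 1 / 10` the bound is `93 / 100`.
  norm_num

/-! ### Operators on Hilbert tensor products and on the free product space. -/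

namespace HilbertTensor

variable {E F G : Type*} [NormedAddCommGroup E] [InnerProductSpace ℂ E]
  [NormedAddCommGroup F] [InnerProductSpace ℂ F] [NormedAddCommGroup G] [InnerProductSpace ℂ G]

theorem clm_ext {S T : HilbertTensor E F →L[ℂ] G} (h : ∀ e f, S (tmul e f) = T (tmul e f)) :
    S = T := by
  ext x
  exact mem_of_tmul_mem (LinearMap.eqLocus S.toLinearMap T.toLinearMap)
    (isClosed_eq S.continuous T.continuous) h x

theorem map_one_id : map (1 : E →L[ℂ] E) (ContinuousLinearMap.id ℂ F) = 1 :=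
  clm_ext fun e f => map_tmul _ _ e f

theorem map_mul_id (x y : E →L[ℂ] E) :
    map (x * y) (ContinuousLinearMap.id ℂ F) =
      map x (ContinuousLinearMap.id ℂ F) * map y (ContinuousLinearMap.id ℂ F) :=
  clm_ext fun e f => by
    have h := map_tmul x (ContinuousLinearMap.id ℂ F) (y e) f
    have h' := map_tmul y (ContinuousLinearMap.id ℂ F) e f
    rw [ContinuousLinearMap.id_apply] at h h'
    rw [map_tmul]
    exact (h.symm.trans (congrArg _ h'.symm))

theorem map_star_id [CompleteSpace E] (x : E →L[ℂ] E) :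
    map (star x) (ContinuousLinearMap.id ℂ F) = star (map x (ContinuousLinearMap.id ℂ F)) := by
  refine clm_ext fun e f => ?_
  rw [← sub_eq_zero, ← inner_self_eq_zero (𝕜 := ℂ)]
  -- Fixing one argument of the inner product as `w` leaves a closed linear condition on the other,
  -- which can be checked on elementary tensors.
  generalize hw : map (star x) (ContinuousLinearMap.id ℂ F) (tmul e f) -
    star (map x (ContinuousLinearMap.id ℂ F)) (tmul e f) = w
  refine mem_of_tmul_mem (LinearMap.ker (innerSL ℂ w).toLinearMap)
    (innerSL ℂ w).isClosed_ker (fun e' f' => ?_) w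
  change inner ℂ w (tmul e' f') = 0
  rw [← hw, inner_sub_left, map_tmul, ContinuousLinearMap.star_eq_adjoint,
    ContinuousLinearMap.star_eq_adjoint, ContinuousLinearMap.adjoint_inner_left, map_tmul,
    inner_tmul, inner_tmul, ContinuousLinearMap.adjoint_inner_left]
  exact sub_self _

end HilbertTensor

namespace FreeProd

variable {ι : Type} {H : ι → Type u} [∀ i, NormedAddCommGroup (H i)]
  [∀ i, InnerProductSpace ℂ (H i)] {ξ : ∀ i, H i} [DecidableEq ι] {i : ι} (hξ : ‖ξ i‖ = 1)

theorem leftAction_leftVec (x : H i →L[ℂ] H i) (η : H i) (f : SpaceAvoiding H ξ i) :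
    leftAction H ξ i hξ x (leftVec H ξ i hξ η f) = leftVec H ξ i hξ (x η) f := by
  have h : ∀ η, leftUnitary H ξ i hξ (HilbertTensor.tmul η f) = leftVec H ξ i hξ η f :=
    fun η => leftIsometry_tmul H ξ i hξ η f
  rw [← h, ← h, leftAction, LinearIsometryEquiv.conjStarAlgEquiv_apply_apply,
    LinearIsometryEquiv.symm_apply_apply, HilbertTensor.map_tmul]
  rfl

theorem leftAction_one : leftAction H ξ i hξ 1 = 1 := by
  rw [leftAction, HilbertTensor.map_one_id, map_one]

theorem leftAction_mul (x y : H i →L[ℂ] H i) :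
    leftAction H ξ i hξ (x * y) = leftAction H ξ i hξ x * leftAction H ξ i hξ y := by
  rw [leftAction, HilbertTensor.map_mul_id, map_mul]
  rfl

theorem leftAction_star [CompleteSpace (H i)] (x : H i →L[ℂ] H i) :
    leftAction H ξ i hξ (star x) = star (leftAction H ξ i hξ x) := by
  rw [leftAction, HilbertTensor.map_star_id]
  exact (leftUnitary H ξ i hξ).conjStarAlgEquiv.map_star' _

theorem inner_leftVec (η η' : H i) (f f' : SpaceAvoiding H ξ i) :
    inner ℂ (leftVec H ξ i hξ η f) (leftVec H ξ i hξ η' f') = inner ℂ η η' * inner ℂ f f' :=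
  (lp.hasSum_inner (𝕜 := ℂ) (leftVec H ξ i hξ η f) (leftVec H ξ i hξ η' f')).unique
    (hasSum_leftCoord H ξ i hξ η η' f f')

/-- The inclusion `f ↦ V i (ξ i ⊗ f)` of `H(i)` in the free product space. -/
noncomputable def avoidingInclusion : SpaceAvoiding H ξ i →ₗᵢ[ℂ] Space H ξ :=
  (leftBilin H ξ i hξ (ξ i)).isometryOfInner fun f f' => by
    refine (inner_leftVec hξ (ξ i) (ξ i) f f').trans ?_
    rw [inner_self_eq_norm_sq_to_K, hξ]
    simp

theorem avoidingInclusion_apply (f : SpaceAvoiding H ξ i) :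
    avoidingInclusion hξ f = leftVec H ξ i hξ (ξ i) f := rfl

/-- The projection of the free product space onto `H(i)`. -/
noncomputable def avoidingProjection : Space H ξ →L[ℂ] Space H ξ :=
  (avoidingInclusion hξ).toContinuousLinearMap ∘L
    ContinuousLinearMap.adjoint (avoidingInclusion hξ).toContinuousLinearMap

theorem adjoint_avoidingInclusion_apply (f : SpaceAvoiding H ξ i) :
    ContinuousLinearMap.adjoint (avoidingInclusion hξ).toContinuousLinearMap
      (avoidingInclusion hξ f) = f := by
  refine ext_inner_left ℂ fun g => ?_
  rw [ContinuousLinearMap.adjoint_inner_right]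
  exact (avoidingInclusion hξ).inner_map_map g f

theorem avoidingProjection_inclusion (f : SpaceAvoiding H ξ i) :
    avoidingProjection hξ (avoidingInclusion hξ f) = avoidingInclusion hξ f :=
  congrArg (avoidingInclusion hξ) (adjoint_avoidingInclusion_apply hξ f)

theorem isStarProjection_avoidingProjection : IsStarProjection (avoidingProjection hξ) where
  isIdempotentElem := by
    ext1 f
    exact avoidingProjection_inclusion hξ _
  isSelfAdjoint := by
    rw [IsSelfAdjoint, ContinuousLinearMap.star_eq_adjoint, avoidingProjection,
      ContinuousLinearMap.adjoint_comp, ContinuousLinearMap.adjoint_adjoint]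

/-- On vectors `ξ i ⊗ f` and `ξ i ⊗ g` the matrix coefficient of `x ⊗ 1` carries the factor `⟪ξ i, x
(ξ i)⟫`, which for a GNS representation is the value of the state. -/
theorem avoidingProjection_mul_leftAction_mul {x : H i →L[ℂ] H i}
    (hx : inner ℂ (ξ i) (x (ξ i)) = 0) :
    avoidingProjection hξ * leftAction H ξ i hξ x * avoidingProjection hξ = 0 := by
  have h : ∀ f, ContinuousLinearMap.adjoint (avoidingInclusion hξ).toContinuousLinearMap
      (leftAction H ξ i hξ x (avoidingInclusion hξ f)) = 0 := fun f => by
    refine ext_inner_left ℂ fun g => ?_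
    rw [ContinuousLinearMap.adjoint_inner_right, inner_zero_right]
    change inner ℂ (leftVec H ξ i hξ (ξ i) g)
      (leftAction H ξ i hξ x (leftVec H ξ i hξ (ξ i) f)) = 0
    rw [leftAction_leftVec, inner_leftVec, hx, zero_mul]
  ext1 f
  exact (congrArg (avoidingInclusion hξ) (h _)).trans (map_zero _)

theorem avoidingProjection_single_incl (l : WordAvoiding i) (t : WordSpace H ξ l.1) :
    avoidingProjection hξ (lp.single (E := fun l : Word ι => WordSpace H ξ l.1) 2 l.incl t) =
      lp.single (E := fun l : Word ι => WordSpace H ξ l.1) 2 l.incl t := by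
  rw [← leftVec_single_incl H ξ i hξ l t]
  exact avoidingProjection_inclusion hξ _

theorem avoidingProjection_single_cons (l : WordAvoiding i) (t : WordSpace H ξ (i :: l.1)) :
    avoidingProjection hξ (lp.single (E := fun l : Word ι => WordSpace H ξ l.1) 2 l.cons t) =
      0 := by
  have h : ContinuousLinearMap.adjoint (avoidingInclusion hξ).toContinuousLinearMap
      (lp.single (E := fun l : Word ι => WordSpace H ξ l.1) 2 l.cons t) = 0 := by
    refine ext_inner_left ℂ fun g => ?_
    rw [ContinuousLinearMap.adjoint_inner_right, inner_zero_right]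
    refine (lp.inner_single_right (𝕜 := ℂ) (G := fun l : Word ι => WordSpace H ξ l.1)
      l.cons t _).trans ?_
    have h0 : leftCoord H ξ i (ξ i) g l.cons = 0 := by
      rw [leftCoord_cons, Submodule.orthogonalProjectionOnto_orthogonal_apply_eq_zero
        (Submodule.mem_span_singleton_self (ξ i)), zero_tmul]
    change inner ℂ (leftCoord H ξ i (ξ i) g l.cons) t = 0
    rw [h0, inner_zero_left]
  exact (congrArg (avoidingInclusion hξ) h).trans (map_zero _)

/-- The two complements are carried by the words starting with `i` and with `j`, and no word does
both. -/
theorem one_sub_avoidingProjection_mul {j : ι} (hij : i ≠ j) (hξ' : ‖ξ j‖ = 1) :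
    (1 - avoidingProjection hξ) * (1 - avoidingProjection hξ') = 0 := by
  have hs : ∀ (w : Word ι) (t : WordSpace H ξ w.1),
      ((1 - avoidingProjection hξ) * (1 - avoidingProjection hξ'))
        (lp.single (E := fun l : Word ι => WordSpace H ξ l.1) 2 w t) = 0 := by
    intro w
    obtain ⟨l, rfl⟩ | ⟨l, rfl⟩ := w.eq_incl_or_eq_cons j
    · intro t
      rw [mul_apply_eq_comp]
      change (1 - avoidingProjection hξ) (_ - avoidingProjection hξ' _) = 0
      rw [avoidingProjection_single_incl]
      simp
    · intro t
      rw [mul_apply_eq_comp]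
      change (1 - avoidingProjection hξ) (_ - avoidingProjection hξ' _) = 0
      rw [avoidingProjection_single_cons, sub_zero]
      let m : WordAvoiding i := ⟨j :: l.1, List.isChain_cons_cons.2 ⟨hij, l.2⟩⟩
      exact sub_eq_zero.2 (avoidingProjection_single_incl hξ m t).symm
  ext1 f
  refine ((lp.hasSum_single (p := 2) (by simp) f).mapL _).unique ?_
  simp only [hs]
  exact hasSum_zero

/-- By the previous lemma `1 - P j ≤ P i`, so the vanishing of the compression to `P i` passes to `1
- P j`. -/
theorem compl_avoidingProjection_mul_leftAction_mul {j : ι} (hij : i ≠ j) (hξ' : ‖ξ j‖ = 1)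
    {x : H i →L[ℂ] H i} (hx : inner ℂ (ξ i) (x (ξ i)) = 0) :
    (1 - avoidingProjection hξ') * leftAction H ξ i hξ x * (1 - avoidingProjection hξ') = 0 := by
  have h1 := one_sub_avoidingProjection_mul hξ hij hξ'
  have h2 := one_sub_avoidingProjection_mul hξ' hij.symm hξ
  rw [sub_mul, one_mul, sub_eq_zero] at h1
  rw [mul_sub, mul_one, sub_eq_zero] at h2
  have h3 := avoidingProjection_mul_leftAction_mul hξ hx
  calc (1 - avoidingProjection hξ') * leftAction H ξ i hξ x * (1 - avoidingProjection hξ')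
      = (1 - avoidingProjection hξ') * avoidingProjection hξ * leftAction H ξ i hξ x *
        (avoidingProjection hξ * (1 - avoidingProjection hξ')) := by rw [← h1, ← h2]
    _ = (1 - avoidingProjection hξ') *
        (avoidingProjection hξ * leftAction H ξ i hξ x * avoidingProjection hξ) *
        (1 - avoidingProjection hξ') := by simp only [mul_assoc]
    _ = 0 := by rw [h3, mul_zero, zero_mul]

end FreeProd

theorem inner_gnsVector {A : Type*} [CStarAlgebra A] [PartialOrder A] [StarOrderedRing A]
    (τ : A →ₚ[ℂ] ℂ) (a : A) :
    inner ℂ (gnsVector τ) (τ.gnsStarAlgHom a (gnsVector τ)) = τ a := by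
  rw [gnsVector]
  refine (congrArg _ (τ.gnsNonUnitalStarAlgHom_apply_coe)).trans ?_
  rw [UniformSpace.Completion.inner_coe, PositiveLinearMap.preGNS_inner_def]
  simp

/-! ### The canonical representations of the factors. -/

section ReducedFreeProduct

variable {ι : Type} [DecidableEq ι] {A : ι → Type u} [∀ i, CStarAlgebra (A i)]
  [∀ i, PartialOrder (A i)] [∀ i, StarOrderedRing (A i)] {τ : ∀ i, A i →ₚ[ℂ] ℂ}
  (hτ : ∀ i, τ i 1 = 1) {i : ι}

theorem freeRep_one : freeRep τ hτ i 1 = 1 := by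
  rw [freeRep, map_one, FreeProd.leftAction_one]

theorem freeRep_mul (a b : A i) : freeRep τ hτ i (a * b) = freeRep τ hτ i a * freeRep τ hτ i b := by
  rw [freeRep, map_mul, FreeProd.leftAction_mul]
  rfl

theorem freeRep_star (a : A i) : freeRep τ hτ i (star a) = star (freeRep τ hτ i a) := by
  rw [freeRep, map_star, FreeProd.leftAction_star]
  rfl

theorem freeRep_mem_unitary {a : A i} (ha : a ∈ unitary (A i)) :
    freeRep τ hτ i a ∈ unitary (FreeGNS τ →L[ℂ] FreeGNS τ) := by
  rw [Unitary.mem_iff] at ha ⊢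
  rw [← freeRep_star, ← freeRep_mul, ← freeRep_mul, ha.1, ha.2, freeRep_one]
  exact ⟨rfl, rfl⟩

theorem freeRep_mem (a : A i) : freeRep τ hτ i a ∈ reducedFreeProduct τ hτ :=
  StarSubalgebra.le_topologicalClosure _
    (StarAlgebra.subset_adjoin ℂ _ (Set.mem_iUnion_of_mem i ⟨a, rfl⟩))

theorem nontrivial_freeGNS : Nontrivial (FreeGNS τ) := by
  let v : EuclideanSpace ℂ PUnit.{u + 1} := WithLp.toLp 2 fun _ => 1
  let f : FreeGNS τ := lp.single (E := fun l : FreeProd.Word ι => FreeProd.WordSpace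
    (fun i => (τ i).GNS) (fun i => gnsVector (τ i)) l.1) 2 ⟨[], List.isChain_nil⟩ v
  refine ⟨f, 0, fun h => ?_⟩
  have h1 : v = 0 := (lp.single_apply_self (E := fun l : FreeProd.Word ι => FreeProd.WordSpace
    (fun i => (τ i).GNS) (fun i => gnsVector (τ i)) l.1) 2 ⟨[], List.isChain_nil⟩ v).symm.trans
    (congrArg (fun g : FreeGNS τ => g ⟨[], List.isChain_nil⟩) h)
  exact one_ne_zero (congrArg (fun g : EuclideanSpace ℂ PUnit.{u + 1} => g PUnit.unit) h1)

end ReducedFreeProduct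

/-! ### The norm bound with matrix coefficients, and the contradiction with quasidiagonality. -/

section MatrixBound

variable {A B J : Type*} [CStarAlgebra A] [CStarAlgebra B] [Fintype J] [DecidableEq J]

/-- The diagonal embedding of an algebra into its matrices. -/
noncomputable def diagonalHom (J B : Type*) [CStarAlgebra B] [Fintype J] [DecidableEq J] :
    B →⋆ₙₐ[ℂ] CStarMatrix J J B where
  toFun x := CStarMatrix.ofMatrix (Matrix.diagonal fun _ => x)
  map_smul' c x := Matrix.diagonal_smul c fun _ => x
  map_zero' := Matrix.diagonal_zero
  map_add' x y := (Matrix.diagonal_add (fun _ => x) fun _ => y).symm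
  map_mul' x y := (Matrix.diagonal_mul_diagonal (fun _ => x) fun _ => y).symm
  map_star' x := (Matrix.diagonal_conjTranspose fun _ => x).symm

theorem mul_diagonalHom_apply (M : CStarMatrix J J B) (x : B) (i j : J) :
    (M * diagonalHom J B x) i j = M i j * x :=
  (CStarMatrix.mul_apply).trans (Matrix.mul_diagonal (fun _ => x) M i j)

theorem diagonalHom_mul_apply (M : CStarMatrix J J B) (x : B) (i j : J) :
    (diagonalHom J B x * M) i j = x * M i j :=
  (CStarMatrix.mul_apply).trans (Matrix.diagonal_mul (fun _ => x) M i j)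

/-- The embedding of scalar matrices into the matrices over an algebra. -/
noncomputable def scalarMatrixHom (J B : Type*) [CStarAlgebra B] [Fintype J] :
    CStarMatrix J J ℂ →⋆ₙₐ[ℂ] CStarMatrix J J B :=
  CStarMatrix.mapₙₐ ((StarAlgHom.ofId ℂ B : ℂ →⋆ₐ[ℂ] B) : ℂ →⋆ₙₐ[ℂ] B)

theorem scalarMatrixHom_apply {J B : Type*} [CStarAlgebra B] [Fintype J]
    (M : CStarMatrix J J ℂ) (i j : J) :
    scalarMatrixHom J B M i j = algebraMap ℂ B (M i j) := rfl

/-- Scalar matrices commute with the diagonal copies of the `e i`, so multiplying by `m i` preserves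
the hypothesis relating `v i` to `e i`. -/
theorem norm_sum_smul_le_of_projections [PartialOrder B] [StarOrderedRing B] {ι : Type*}
    [Fintype ι] {e v : ι → B}
    (he : ∀ i, IsStarProjection (e i)) (horth : Pairwise fun i j => e i * e j = 0)
    (hv : ∀ i, ‖v i‖ ≤ 1) (hve : ∀ i, e i * (v i * (1 - e i)) = v i * (1 - e i))
    {m : ι → CStarMatrix J J ℂ} (hm : ∀ i, ‖m i‖ ≤ 1) :
    ‖∑ i, scalarMatrixHom J B (m i) * diagonalHom J B (v i)‖ ≤ 3 * √(Fintype.card ι) := by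
  refine norm_sum_le_of_projections (e := fun i => diagonalHom J B (e i))
    (fun i => (he i).map _) (fun i j hij => ?_) (fun i => ?_) fun i => ?_
  · change diagonalHom J B (e i) * diagonalHom J B (e j) = 0
    rw [← map_mul, horth hij, map_zero]
  · refine (norm_mul_le _ _).trans (mul_le_one₀ ?_ (norm_nonneg _) ?_)
    · exact (NonUnitalStarAlgHom.norm_apply_le (scalarMatrixHom J B) (m i)).trans (hm i)
    · exact (NonUnitalStarAlgHom.norm_apply_le (diagonalHom J B) (v i)).trans (hv i)
  · have h : v i - v i * e i = e i * (v i - v i * e i) := by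
      have := hve i
      rw [mul_sub (v i), mul_one] at this
      exact this.symm
    have hc : diagonalHom J B (e i) * scalarMatrixHom J B (m i) =
        scalarMatrixHom J B (m i) * diagonalHom J B (e i) := by
      ext a b
      rw [diagonalHom_mul_apply, mul_diagonalHom_apply, scalarMatrixHom_apply]
      exact (Algebra.commutes _ _).symm
    rw [mul_assoc, ← mul_sub, ← map_mul, ← map_sub, ← mul_assoc, hc, mul_assoc, ← map_mul, ← h]

end MatrixBound

/-- A `C⋆`-algebra containing sufficiently many isometries `v i`, each of which maps the complement
of a projection `e i` into its range, with the `e i` pairwise orthogonal projections in a larger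
algebra, is not quasidiagonal. -/
theorem not_isQuasidiagonal_of_projections {A : Type u} {B : Type*} [CStarAlgebra A] [Nontrivial A]
    [CStarAlgebra B] [PartialOrder B] [StarOrderedRing B] (φ : A →⋆ₙₐ[ℂ] B)
    (hφ : Function.Injective φ) {v : Fin 16 → A} {e : Fin 16 → B}
    (hv : ∀ i, star (v i) * v i = 1)
    (he : ∀ i, IsStarProjection (e i)) (horth : Pairwise fun i j => e i * e j = 0)
    (hve : ∀ i, e i * (φ (v i) * (1 - e i)) = φ (v i) * (1 - e i)) :
    ¬ IsQuasidiagonal.{u, w} A := by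
  classical
  intro h
  obtain ⟨K, _, _, _, π, J, _, _, f, hf, hfs⟩ := h.exists_orthonormal hv
  let _ : PartialOrder A := CStarAlgebra.spectralOrder A
  have : StarOrderedRing A := CStarAlgebra.spectralOrderedRing A
  have hv1 : ∀ i, ‖v i‖ ≤ 1 := fun i => by
    have h1 : ‖v i‖ * ‖v i‖ = 1 := by rw [← CStarRing.norm_star_mul_self, hv, norm_one]
    nlinarith [norm_nonneg (v i)]
  -- Conjugate coefficients make each term of the pairing with `f` a squared modulus, so nothing
  -- cancels in the sum over `i`.
  let m : Fin 16 → CStarMatrix J J ℂ := fun i =>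
    CStarMatrix.ofMatrix (Matrix.of fun a b => inner ℂ (π (v i) (f b)) (f a))
  have hm : ∀ i, ‖m i‖ ≤ 1 := fun i => norm_conj_matrix_le_one hf
    ((NonUnitalStarAlgHom.norm_apply_le π (v i)).trans (hv1 i))
  let M : CStarMatrix J J A := ∑ i, scalarMatrixHom J A (m i) * diagonalHom J A (v i)
  have hMapply : ∀ a b, M a b = ∑ i, m i a b • v i := fun a b => by
    have : M a b = ∑ i, (scalarMatrixHom J A (m i) * diagonalHom J A (v i)) a b :=
      Matrix.sum_apply a b Finset.univ _
    rw [this]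
    refine Finset.sum_congr rfl fun i _ => ?_
    rw [mul_diagonalHom_apply, scalarMatrixHom_apply, Algebra.algebraMap_eq_smul_one,
      smul_one_mul]
  have hM : ‖M‖ ≤ 12 := by
    -- The projections live only in `B`, so the norm is computed there; an injective star
    -- homomorphism is isometric, also on matrices.
    have hinj : Function.Injective (CStarMatrix.mapₙₐ (n := J) φ) :=
      CStarMatrix.map_injective hφ
    rw [← NonUnitalStarAlgHom.norm_map _ hinj]
    have hmap : CStarMatrix.mapₙₐ φ M =
        ∑ i, scalarMatrixHom J B (m i) * diagonalHom J B (φ (v i)) := by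
      ext a b
      have h1 : (∑ i, scalarMatrixHom J B (m i) * diagonalHom J B (φ (v i))) a b =
          ∑ i, (scalarMatrixHom J B (m i) * diagonalHom J B (φ (v i))) a b :=
        Matrix.sum_apply a b Finset.univ _
      have h2 : CStarMatrix.mapₙₐ φ M a b = φ (M a b) := rfl
      rw [h1, h2, hMapply, map_sum]
      refine Finset.sum_congr rfl fun i _ => ?_
      rw [mul_diagonalHom_apply, scalarMatrixHom_apply, map_smul,
        Algebra.algebraMap_eq_smul_one, smul_one_mul]
    rw [hmap]
    have h := norm_sum_smul_le_of_projections he horth (v := fun i => φ (v i))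
      (fun i => (NonUnitalStarAlgHom.norm_apply_le φ (v i)).trans (hv1 i)) hve hm
    refine h.trans_eq ?_
    rw [Fintype.card_fin, show ((16 : ℕ) : ℝ) = 4 ^ 2 by norm_num, Real.sqrt_sq (by norm_num)]
    norm_num
  have hle := norm_inner_matrixOperator_le π M f hf.norm_eq_one
  have hsum : ∑ a, ∑ b, inner ℂ (f a) (π (M a b) (f b)) =
      ((∑ i, ∑ b, ∑ a, ‖inner ℂ (f a) (π (v i) (f b))‖ ^ 2 : ℝ) : ℂ) := by
    have h1 : ∀ a b, inner ℂ (f a) (π (M a b) (f b)) =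
        ∑ i, ((‖inner ℂ (f a) (π (v i) (f b))‖ ^ 2 : ℝ) : ℂ) := fun a b => by
      rw [hMapply, map_sum, sum_apply, inner_sum]
      refine Finset.sum_congr rfl fun i _ => ?_
      rw [map_smul, smul_apply, inner_smul_right]
      change inner ℂ (π (v i) (f b)) (f a) * _ = _
      rw [← inner_conj_symm, Complex.conj_mul']
      push_cast
      rfl
    simp only [h1]
    push_cast
    rw [Finset.sum_comm, Finset.sum_comm (s := Finset.univ (α := Fin 16))]
    refine Finset.sum_congr rfl fun b _ => Finset.sum_comm
  rw [hsum, Complex.norm_real, Real.norm_eq_abs] at hle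
  have hlow : (16 * (Fintype.card J * (9 / 10)) : ℝ) ≤
      ∑ i, ∑ b, ∑ a, ‖inner ℂ (f a) (π (v i) (f b))‖ ^ 2 := by
    calc (16 * (Fintype.card J * (9 / 10)) : ℝ) = ∑ _i : Fin 16, ∑ _b : J, (9 / 10 : ℝ) := by simp
      _ ≤ _ := Finset.sum_le_sum fun i _ => Finset.sum_le_sum fun b _ => hfs i b
  have hJ : (0 : ℝ) < Fintype.card J := by exact_mod_cast Fintype.card_pos
  have := (hlow.trans (le_abs_self _)).trans (hle.trans (mul_le_mul_of_nonneg_right hM hJ.le))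
  -- The lower bound is `14.4 * card J`, the upper bound `12 * card J`; `16` is a perfect square
  -- with `3 * √16 < (9 / 10) * 16`.
  linarith

/-- A `C⋆`-subalgebra that contains unitaries in the position of Avitzour's condition with respect
to some projection `P` is not quasidiagonal. -/
theorem not_isQuasidiagonal_of_avitzour {B : Type u} [CStarAlgebra B] [PartialOrder B]
    [StarOrderedRing B] [Nontrivial B] (S : StarSubalgebra ℂ B) [IsClosed (S : Set B)]
    {P a b c : B} (hP : IsStarProjection P) (haS : a ∈ S) (hbS : b ∈ S) (hcS : c ∈ S)
    (hau : a ∈ unitary B) (hbu : b ∈ unitary B) (hcu : c ∈ unitary B)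
    (hb : P * b * P = 0) (hc : P * c * P = 0) (hbc : P * (star b * c) * P = 0)
    (ha : (1 - P) * a * (1 - P) = 0) : ¬ IsQuasidiagonal.{u, w} S := by
  obtain ⟨e, he, horth, hue⟩ := exists_projections_of_avitzour hP hau hbu hcu hb hc hbc ha
  have hgS : ∀ n, (c * a) ^ n * b ∈ S := fun n => mul_mem (pow_mem (mul_mem hcS haS) n) hbS
  have hgu : ∀ n, (c * a) ^ n * b ∈ unitary B := fun n =>
    mul_mem (pow_mem (mul_mem hcu hau) n) hbu
  let u : ℕ → S := fun n => ⟨(c * a) ^ n * b * a * star ((c * a) ^ n * b),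
    mul_mem (mul_mem (hgS n) haS) (star_mem (hgS n))⟩
  have hu : ∀ n, star (u n) * u n = 1 := fun n => Subtype.ext
    (Unitary.mem_iff.1 (mul_mem (mul_mem (hgu n) hau) (Unitary.star_mem (hgu n)))).1
  exact not_isQuasidiagonal_of_projections (S.subtype : S →⋆ₙₐ[ℂ] B)
    Subtype.val_injective (v := fun i : Fin 16 => u i) (e := fun i : Fin 16 => e i)
    (fun i => hu i) (fun i => he i) (fun i j hij => horth fun h => hij (Fin.ext h))
    fun i => hue i

theorem theorem4p1p1 {A : Fin 2 → Type u} [∀ i, CStarAlgebra (A i)]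
    [∀ i, PartialOrder (A i)] [∀ i, StarOrderedRing (A i)]
    [∀ i, TopologicalSpace.SeparableSpace (A i)]
    (τ : ∀ i, A i →ₚ[ℂ] ℂ) (hτ : ∀ i, IsFaithfulTracialState (τ i))
    (avitzour : ∃ a ∈ unitary (A 0), ∃ b ∈ unitary (A 1), ∃ c ∈ unitary (A 1),
      τ 0 a = 0 ∧ τ 1 b = 0 ∧ τ 1 c = 0 ∧ τ 1 (star c * b) = 0) :
    ¬ IsQuasidiagonal.{u, w} (reducedFreeProduct τ fun i => (hτ i).map_one) := by
  obtain ⟨a, ha, b, hb, c, hc, ha0, hb0, hc0, hcb⟩ := avitzour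
  have h1 : ∀ i, τ i 1 = 1 := fun i => (hτ i).map_one
  have hξ : ∀ i, ‖gnsVector (τ i)‖ = 1 := fun i => norm_gnsVector (τ i) (h1 i)
  -- A positive functional is hermitian, so the trace condition passes to the adjoint `star b * c`.
  have hbc : τ 1 (star b * c) = 0 := by
    have h := map_star (τ 1) (star c * b)
    rw [hcb, star_zero] at h
    simpa using h
  have hP : ∀ x : A 1, τ 1 x = 0 → FreeProd.avoidingProjection (ξ := fun i => gnsVector (τ i))
      (hξ 1) * freeRep τ h1 1 x * FreeProd.avoidingProjection (hξ 1) = 0 := fun x hx =>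
    FreeProd.avoidingProjection_mul_leftAction_mul (hξ 1) ((inner_gnsVector _ _).trans hx)
  -- The vacuum vector makes the operator algebra nonzero, so that a faithful representation has a
  -- nonzero image of the unit.
  have := nontrivial_freeGNS (τ := τ)
  exact not_isQuasidiagonal_of_avitzour (reducedFreeProduct τ h1)
    (FreeProd.isStarProjection_avoidingProjection (ξ := fun i => gnsVector (τ i)) (hξ 1))
    (freeRep_mem h1 a) (freeRep_mem h1 b) (freeRep_mem h1 c)
    (freeRep_mem_unitary h1 ha) (freeRep_mem_unitary h1 hb) (freeRep_mem_unitary h1 hc)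
    (hP b hb0) (hP c hc0) (by rw [← freeRep_star, ← freeRep_mul]; exact hP _ hbc)
    (FreeProd.compl_avoidingProjection_mul_leftAction_mul (hξ 0) (by decide) (hξ 1)
      ((inner_gnsVector _ _).trans ha0))
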